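/- Let $\Gamma$ be a metrized graph, i.e. a finite connected graph (multiple edges and self-loops allowed) with finite non-empty vertex set $V$ and edges $e_i$ parametrized by intervals of length $L_i>0$. Let $\ell(\Gamma)=\sum_i L_i$, let $\upsilon(p)$ be the valence of a vertex $p$ (a self-loop counts twice), and let $r(x,y)$ be the effective resistance between $x,y\in\Gamma$ when each edge is viewed as a resistor whose resistance is its length. Let $R_i$ be the effective resistance between the end points of $e_i$ after the interior of $e_i$ is deleted ($R_i=\infty$, $\frac{1}{L_i+R_i}=0$ if $e_i$ is a bridge). For ${\bf q}:V\to\mathbb{N}=\{0,1,\dots\}$, the pair $(\Gamma,{\bf q})$ is a polarized metrized graph (pm-graph) if $\upsilon(p)-2+2{\bf q}(p)\ge 0$ for all $p\in V$. Its genus is $\bar g(\Gamma)=|E|-|V|+1+\sum_{p}{\bf q}(p)$, where $E$ is the set of edges. Put $$\delta_K=\sum_{p\in V}(\upsilon(p)-2+2{\bf q}(p))\,\delta_p,\qquad \mu_{ad}=\frac{1}{\bar g}\Big(\sum_{p\in V}{\bf q}(p)\,\delta_p+\sum_{i}\frac{dx}{L_i+R_i}\Big),$$ $$\epsilon(\Gamma)=\iint_{\Gamma\times\Gamma}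 r(x,y)\,\delta_K(x)\,\mu_{ad}(y),\qquad Z(\Gamma)=\frac12\iint_{\Gamma\times\Gamma} r(x,y)\,\mu_{ad}(x)\,\mu_{ad}(y),$$ $$\varphi(\Gamma)=3\bar g\, Z(\Gamma)-\tfrac14(\epsilon(\Gamma)+\ell(\Gamma)),\qquad \lambda(\Gamma)=\frac{\bar g-1}{6(2\bar g+1)}\varphi(\Gamma)+\tfrac1{12}(\epsilon(\Gamma)+\ell(\Gamma)).$$ Let $(\Gamma,{\bf q})$ be a pm-graph with a self-loop of length $L$ at a vertex $p$ with $\upsilon(p)\ge 3$. Let $\beta$ be the graph obtained from $\Gamma$ by deleting (the interior of) this self-loop, with $\bar{\bf q}(p)={\bf q}(p)+1$ and $\bar{\bf q}(x)={\bf q}(x)$ for the vertices $x\neq p$. Then $(\beta,\bar{\bf q})$ is a pm-graph with $\bar g(\beta)=\bar g(\Gamma)$, and with $\bar g=\bar g(\Gamma)$, $$\varphi(\Gamma)=\varphi(\beta)+\frac{\bar g-1}{6\bar g}L,\qquad Z(\Gamma)=Z(\beta)+\frac{2\bar g-1}{12\bar g^2}L,$$ $$\lambda(\Gamma)=\lambda(\beta)+\frac{\bar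 g}{8\bar g+4}L,\qquad \epsilon(\Gamma)=\epsilon(\beta)+\frac{\bar g-1}{3\bar g}L.$$ -/

import Mathlib

open MeasureTheory
open scoped ENNReal

noncomputable section

/-- A finite multigraph (multiple edges and self-loops allowed) with vertices `V`, edges `E` and
positive edge lengths.  The edge `e` is parametrized by `[0, len e]`, from `src e` to `tgt e`.
Connectedness is a separate predicate, because deleting an edge may destroy it. -/
structure MetricMultigraph (V E : Type*) where
  src : E → V
  tgt : E → V
  len : E → ℝ
  len_pos : ∀ e, 0 < len e

namespace MetricMultigraph

/-- Nonempty and any two vertices are joined by a path (edges may be traversed both ways). -/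
def Connected {V E : Type*} (G : MetricMultigraph V E) : Prop :=
  Nonempty V ∧ ∀ u v : V, Relation.EqvGen (fun a b => ∃ e, G.src e = a ∧ G.tgt e = b) u v

/-- The points of the metrized graph: the vertices and the interior points of the edges;
`Sum.inr ⟨e, t⟩` is the point of `e` at distance `t` from `src e` along `e`. -/
def Point {V E : Type*} (G : MetricMultigraph V E) : Type _ :=
  V ⊕ (Σ e : E, Set.Ioo (0 : ℝ) (G.len e))

/-- The Borel sigma-algebra of the metrized graph: a set is measurable iff its trace on each
open edge is Borel. -/
instance {V E : Type*} (G : MetricMultigraph V E) : MeasurableSpace G.Point :=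
  letI : MeasurableSpace V := ⊤
  inferInstanceAs (MeasurableSpace (V ⊕ (Σ e : E, Set.Ioo (0 : ℝ) (G.len e))))

/-- A vertex as a point of the metrized graph. -/
def vertex {V E : Type*} (G : MetricMultigraph V E) (v : V) : G.Point := Sum.inl v

/-- The point in the interior of the edge `e` with parameter `t`. -/
def onEdge {V E : Type*} (G : MetricMultigraph V E) (e : E) (t : Set.Ioo (0 : ℝ) (G.len e)) :
    G.Point := Sum.inr ⟨e, t⟩

/-- Deletion of the interior of an edge. -/
def deleteEdge {V E : Type*} (G : MetricMultigraph V E) (e : E) :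
    MetricMultigraph V {e' : E // e' ≠ e} where
  src e' := G.src e'
  tgt e' := G.tgt e'
  len e' := G.len e'
  len_pos e' := G.len_pos e'

/-- Enlarging the vertex set by the interior point of `e` with parameter `t`.  The new vertex is
`none`; the edge `some e` is the part of `e` before it and the edge `none` the part after it. -/
def subdivide {V E : Type*} [DecidableEq E] (G : MetricMultigraph V E) (e : E)
    (t : Set.Ioo (0 : ℝ) (G.len e)) : MetricMultigraph (Option V) (Option E) where
  src
    | none => none
    | some e' => some (G.src e')
  tgt
    | none => some (G.tgt e)
    | some e' => if e' = e then none else some (G.tgt e')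
  len
    | none => G.len e - t
    | some e' => if e' = e then t else G.len e'
  len_pos
    | none => sub_pos.2 t.2.2
    | some e' => by
        show 0 < if e' = e then (t : ℝ) else G.len e'
        split_ifs
        · exact t.2.1
        · exact G.len_pos e'

/-- The same point, seen in the graph with the enlarged vertex set. -/
def toSubdivide {V E : Type*} [DecidableEq E] (G : MetricMultigraph V E) (e : E)
    (t : Set.Ioo (0 : ℝ) (G.len e)) : G.Point → (G.subdivide e t).Point
  | Sum.inl v => vertex _ (some v)
  | Sum.inr ⟨e', s⟩ =>
      if h : e' = e then
        if hlt : (s : ℝ) < t then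
          onEdge _ (some e') ⟨s, s.2.1, by simpa [subdivide, h] using hlt⟩
        else if hgt : (t : ℝ) < s then
          onEdge _ none ⟨s - t, sub_pos.2 hgt, by
            subst h
            exact sub_lt_sub_right s.2.2 _⟩
        else vertex _ none
      else onEdge _ (some e') ⟨s, s.2.1, by simpa [subdivide, h] using s.2.2⟩

/-- `f` is the potential in the resistive circuit `G` (each edge being a resistor whose resistance
is its length) when a unit current enters at `y` and exits at `x`: by Ohm's law the current
along `e`, from `src e` to `tgt e`, is `(f (src e) - f (tgt e)) / len e`, and by Kirchhoff's law
the total current leaving a node along its edges is the current fed into the node. -/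
def IsPotential {V E : Type*} [DecidableEq V] [Fintype E] (G : MetricMultigraph V E)
    (x y : V) (f : V → ℝ) : Prop :=
  ∀ v : V,
    ∑ e : E, ((if G.src e = v then 1 else 0) - (if G.tgt e = v then 1 else 0)) *
        ((f (G.src e) - f (G.tgt e)) / G.len e) =
      (if v = y then 1 else 0) - (if v = x then 1 else 0)

/-- The potential drop does not depend on the choice of the potential. -/
theorem IsPotential.drop_eq {V E : Type*} [DecidableEq V] [Fintype V] [Fintype E]
    {G : MetricMultigraph V E} {x y : V} {f g : V → ℝ}
    (hf : G.IsPotential x y f) (hg : G.IsPotential x y g) : f y - f x = g y - g x := by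
  have key : ∀ a b : V → ℝ, G.IsPotential x y a →
      b y - b x = ∑ e : E, (b (G.src e) - b (G.tgt e)) *
        ((a (G.src e) - a (G.tgt e)) / G.len e) := by
    intro a b ha
    have h1 : b y - b x
        = ∑ v : V, b v * ((if v = y then 1 else 0) - (if v = x then 1 else 0)) := by
      simp [mul_sub, Finset.sum_sub_distrib]
    rw [h1, Finset.sum_congr rfl fun v _ => by rw [← ha v, Finset.mul_sum], Finset.sum_comm]
    refine Finset.sum_congr rfl fun e _ => ?_
    simp only [← mul_assoc, ← Finset.sum_mul]
    congr 1
    simp [mul_sub, Finset.sum_sub_distrib]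
  rw [key g f hg, key f g hf]
  refine Finset.sum_congr rfl fun e _ => ?_
  ring

/-- The effective resistance between two vertices: the potential difference needed for a unit
current, and `∞` if no current can flow (the vertices lie in different components). -/
def effRes {V E : Type*} [DecidableEq V] [Fintype E] (G : MetricMultigraph V E)
    (x y : V) : ℝ≥0∞ :=
  ⨅ (f : V → ℝ) (_ : G.IsPotential x y f), ENNReal.ofReal (f y - f x)

theorem effRes_eq {V E : Type*} [DecidableEq V] [Fintype V] [Fintype E]
    {G : MetricMultigraph V E} {x y : V} {f : V → ℝ} (hf : G.IsPotential x y f) :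
    G.effRes x y = ENNReal.ofReal (f y - f x) :=
  le_antisymm (iInf₂_le f hf)
    (le_iInf₂ fun _ hg => (congrArg ENNReal.ofReal (hf.drop_eq hg)).le)

/-- The resistance function `r(x, y)` on the points of a metrized graph: the terminals are first
made vertices by enlarging the vertex set. -/
def r {V E : Type*} [DecidableEq V] [DecidableEq E] [Fintype E]
    (G : MetricMultigraph V E) : G.Point → G.Point → ℝ
  | Sum.inl x, Sum.inl y => (G.effRes x y).toReal
  | Sum.inl x, Sum.inr ⟨e, t⟩ => ((G.subdivide e t).effRes (some x) none).toReal
  | Sum.inr ⟨e, t⟩, y =>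
      match G.toSubdivide e t y with
      | Sum.inl y' => ((G.subdivide e t).effRes none y').toReal
      | Sum.inr ⟨e', t'⟩ =>
          (((G.subdivide e t).subdivide e' t').effRes (some none) none).toReal

/-- `R_e`: the resistance between the end points of `e` after deleting the interior of `e`
(`∞` if `e` is a bridge). -/
def edgeRes {V E : Type*} [DecidableEq V] [DecidableEq E] [Fintype E]
    (G : MetricMultigraph V E) (e : E) : ℝ≥0∞ :=
  (G.deleteEdge e).effRes (G.src e) (G.tgt e)

/-- The number of directions emanating from a vertex; a self-loop counts twice. -/
def valence {V E : Type*} [DecidableEq V] [Fintype E] (G : MetricMultigraph V E) (p : V) : ℕ :=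
  (Finset.univ.filter fun e => G.src e = p).card + (Finset.univ.filter fun e => G.tgt e = p).card

/-- The total length `ℓ`. -/
def totalLength {V E : Type*} [Fintype E] (G : MetricMultigraph V E) : ℝ := ∑ e, G.len e

/-- The coefficient at `p` of the canonical divisor of `(G, q)`. -/
def K {V E : Type*} [DecidableEq V] [Fintype E] (G : MetricMultigraph V E) (q : V → ℕ) (p : V) :
    ℤ :=
  G.valence p - 2 + 2 * q p

/-- `(G, q)` is a polarized metrized graph: `G` is connected and the canonical divisor is
effective. -/
def IsPMGraph {V E : Type*} [DecidableEq V] [Fintype E] (G : MetricMultigraph V E)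
    (q : V → ℕ) : Prop :=
  G.Connected ∧ ∀ p, 0 ≤ G.K q p

/-- The genus of `(G, q)`: first Betti number plus the sum of the values of `q`. -/
def genus {V E : Type*} [Fintype V] [Fintype E] (_G : MetricMultigraph V E) (q : V → ℕ) : ℤ :=
  ((Fintype.card E : ℤ) - Fintype.card V + 1) + ∑ p, (q p : ℤ)

theorem measurable_onEdge {V E : Type*} (G : MetricMultigraph V E) (e : E) :
    Measurable (G.onEdge e) :=
  letI : MeasurableSpace V := ⊤
  measurable_inr.comp (measurable_iff_le_map.2 (iInf_le _ e))

/-- Lebesgue measure `dx` on the edge `e`. -/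
def edgeMeasure {V E : Type*} (G : MetricMultigraph V E) (e : E) : Measure G.Point :=
  ((volume : Measure ℝ).comap ((↑) : Set.Ioo (0 : ℝ) (G.len e) → ℝ)).map (G.onEdge e)

/-- The measure `δ_K` (used only when `K` is effective). -/
def deltaK {V E : Type*} [DecidableEq V] [Fintype V] [Fintype E] (G : MetricMultigraph V E)
    (q : V → ℕ) : Measure G.Point :=
  ∑ p, ENNReal.ofReal (G.K q p : ℝ) • Measure.dirac (G.vertex p)

/-- The admissible measure `μ_ad` of `(G, q)`; a bridge has density `1 / (L + ∞) = 0`. -/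
def muAd {V E : Type*} [DecidableEq V] [DecidableEq E] [Fintype V] [Fintype E]
    (G : MetricMultigraph V E) (q : V → ℕ) : Measure G.Point :=
  (ENNReal.ofReal (G.genus q : ℝ))⁻¹ •
    (∑ p, (q p : ℝ≥0∞) • Measure.dirac (G.vertex p) +
      ∑ e, (ENNReal.ofReal (G.len e) + G.edgeRes e)⁻¹ • G.edgeMeasure e)

/-- The invariant `ε`. -/
def epsilonInv {V E : Type*} [DecidableEq V] [DecidableEq E] [Fintype V] [Fintype E]
    (G : MetricMultigraph V E) (q : V → ℕ) : ℝ :=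
  ∫ x, ∫ y, G.r x y ∂(G.muAd q) ∂(G.deltaK q)

/-- The invariant `Z`. -/
def zInv {V E : Type*} [DecidableEq V] [DecidableEq E] [Fintype V] [Fintype E]
    (G : MetricMultigraph V E) (q : V → ℕ) : ℝ :=
  (1 / 2) * ∫ x, ∫ y, G.r x y ∂(G.muAd q) ∂(G.muAd q)

/-- The invariant `φ`. -/
def phiInv {V E : Type*} [DecidableEq V] [DecidableEq E] [Fintype V] [Fintype E]
    (G : MetricMultigraph V E) (q : V → ℕ) : ℝ :=
  3 * (G.genus q : ℝ) * G.zInv q - (1 / 4) * (G.epsilonInv q + G.totalLength)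

/-- The invariant `λ`. -/
def lambdaInv {V E : Type*} [DecidableEq V] [DecidableEq E] [Fintype V] [Fintype E]
    (G : MetricMultigraph V E) (q : V → ℕ) : ℝ :=
  ((G.genus q : ℝ) - 1) / (6 * (2 * (G.genus q : ℝ) + 1)) * G.phiInv q +
    (1 / 12) * (G.epsilonInv q + G.totalLength)

end MetricMultigraph

end

/-! The Laplacian of a self-loop is zero, since no potential difference can exist across it.
Deleting the loop at `p` therefore leaves the vertex Laplacian unchanged, and with it all
resistances between points of β and all the `R_i` of the other edges. The loop itself has `R = 0`,
so μ_ad gives it density `1 / (g L)`. Deletion thus replaces, with weight `1/g`, the uniform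
probability measure on the loop by a point mass at `p`. The divisor `K` is unchanged: the valence
drops by 2 while `2 q` grows by 2.

A point of the loop at parameter `t` is at resistance `t (L - t) / L` from `p`, with average `L/6`.
Hence the potential `∫ r(x, y) dμ_ad(y)` grows by `L / (6g)` for `x` in β, and at the loop point `s`
it exceeds its value at `p` by `(1 - 1/g) s (L - s) / L`; this uses that μ_ad has mass one, which is
Foster's theorem (`Connected.sum_edge_mass`). Integrating against `K`, of degree `2g - 2`, gives ε;
integrating against μ_ad gives Z; φ and λ follow by algebra.

All resistances are computed from one kernel. A Green function γ on the vertices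
(`Connected.exists_isGreen`) gives `r(x, y) = γ(x,x) - γ(x,y) - γ(y,x) + γ(y,y)`, and it extends to
all points by bilinear interpolation plus the Dirichlet Green function `min (L - max) / L` on each
edge (`IsGreen.r_eq`). This explicit kernel yields measurability, boundedness and the comparison
between Γ and β. -/

noncomputable section

namespace MetricMultigraph

/-- Linear interpolation of a function on the vertices at the point of `e` with parameter `t`. -/
def interp {V E : Type*} (G : MetricMultigraph V E) (e : E) (t : ℝ) (f : V → ℝ) : Option V → ℝ
  | none => (1 - t / G.len e) * f (G.src e) + t / G.len e * f (G.tgt e)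
  | some v => f v

@[simp] theorem interp_none {V E : Type*} (G : MetricMultigraph V E) (e : E) (t : ℝ) (f : V → ℝ) :
    G.interp e t f none = (1 - t / G.len e) * f (G.src e) + t / G.len e * f (G.tgt e) := rfl

@[simp] theorem interp_some {V E : Type*} (G : MetricMultigraph V E) (e : E) (t : ℝ) (f : V → ℝ)
    (v : V) : G.interp e t f (some v) = f v := rfl

/-! ### Discrete Laplacian, energy and Green functions -/

section Laplacian

variable {V E : Type*} [DecidableEq V] [Fintype E]

/-- The Laplacian: the total current leaving `v` when the potential is `f`. -/
def lap (G : MetricMultigraph V E) (f : V → ℝ) (v : V) : ℝ :=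
  ∑ e : E, ((if G.src e = v then 1 else 0) - (if G.tgt e = v then 1 else 0)) *
    ((f (G.src e) - f (G.tgt e)) / G.len e)

theorem isPotential_iff (G : MetricMultigraph V E) (x y : V) (f : V → ℝ) :
    G.IsPotential x y f ↔
      ∀ v, G.lap f v = (if v = y then 1 else 0) - (if v = x then 1 else 0) :=
  Iff.rfl

theorem lap_add (G : MetricMultigraph V E) (f g : V → ℝ) (v : V) :
    G.lap (fun u => f u + g u) v = G.lap f v + G.lap g v := by
  simp only [lap, ← Finset.sum_add_distrib]
  exact Finset.sum_congr rfl fun e _ => by ring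

theorem lap_smul (G : MetricMultigraph V E) (c : ℝ) (f : V → ℝ) (v : V) :
    G.lap (fun u => c * f u) v = c * G.lap f v := by
  simp only [lap, Finset.mul_sum]
  exact Finset.sum_congr rfl fun e _ => by ring

theorem lap_sub (G : MetricMultigraph V E) (f g : V → ℝ) (v : V) :
    G.lap (fun u => f u - g u) v = G.lap f v - G.lap g v := by
  simp only [lap, ← Finset.sum_sub_distrib]
  exact Finset.sum_congr rfl fun e _ => by ring

/-- Green's identity. -/
theorem sum_mul_lap [Fintype V] (G : MetricMultigraph V E) (a b : V → ℝ) :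
    ∑ v, b v * G.lap a v =
      ∑ e : E, (b (G.src e) - b (G.tgt e)) * ((a (G.src e) - a (G.tgt e)) / G.len e) := by
  simp only [lap, Finset.mul_sum]
  rw [Finset.sum_comm]
  refine Finset.sum_congr rfl fun e _ => ?_
  simp only [← mul_assoc, ← Finset.sum_mul]
  congr 1
  simp [mul_sub, Finset.sum_sub_distrib]

theorem sum_mul_lap_comm [Fintype V] (G : MetricMultigraph V E) (a b : V → ℝ) :
    ∑ v, b v * G.lap a v = ∑ v, a v * G.lap b v := by
  rw [sum_mul_lap, sum_mul_lap]
  exact Finset.sum_congr rfl fun e _ => by ring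

theorem sum_lap [Fintype V] (G : MetricMultigraph V E) (a : V → ℝ) : ∑ v, G.lap a v = 0 := by
  simpa using G.sum_mul_lap a fun _ => 1

theorem IsPotential.sum_mul_lap [Fintype V] {G : MetricMultigraph V E} {x y : V} {f : V → ℝ}
    (hf : G.IsPotential x y f) (b : V → ℝ) : ∑ v, b v * G.lap f v = b y - b x := by
  simp only [(G.isPotential_iff x y f).1 hf]
  simp [mul_sub, Finset.sum_sub_distrib]

theorem sum_mul_lap_self_nonneg [Fintype V] (G : MetricMultigraph V E) (a : V → ℝ) :
    0 ≤ ∑ v, a v * G.lap a v := by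
  rw [G.sum_mul_lap]
  refine Finset.sum_nonneg fun e _ => ?_
  rw [← mul_div_assoc]
  exact div_nonneg (mul_self_nonneg _) (G.len_pos e).le

theorem IsPotential.drop_nonneg [Fintype V] {G : MetricMultigraph V E} {x y : V} {f : V → ℝ}
    (hf : G.IsPotential x y f) : 0 ≤ f y - f x := by
  rw [← hf.sum_mul_lap f]
  exact G.sum_mul_lap_self_nonneg f

/-- A fundamental solution of the Laplace equation, up to the fixed source term `ρ`. -/
def IsGreen (G : MetricMultigraph V E) (ρ : V → ℝ) (γ : V → V → ℝ) : Prop :=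
  ∀ y v, G.lap (fun u => γ u y) v = (if v = y then 1 else 0) - ρ v

/-- The source ρ does not depend on the pole, so it cancels in the difference of two columns. -/
theorem IsGreen.isPotential {G : MetricMultigraph V E} {ρ : V → ℝ} {γ : V → V → ℝ}
    (h : G.IsGreen ρ γ) (x y : V) : G.IsPotential x y fun u => γ u y - γ u x := by
  rw [isPotential_iff]
  intro v
  rw [lap_sub, h y v, h x v]
  ring

theorem IsGreen.effRes_toReal [Fintype V] {G : MetricMultigraph V E} {ρ : V → ℝ}
    {γ : V → V → ℝ} (h : G.IsGreen ρ γ) (x y : V) :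
    (G.effRes x y).toReal = γ x x - γ x y - γ y x + γ y y := by
  rw [effRes_eq (h.isPotential x y), ENNReal.toReal_ofReal (h.isPotential x y).drop_nonneg]
  ring

theorem Connected.eq_of_energy_eq_zero [Fintype V] {G : MetricMultigraph V E} (hG : G.Connected)
    {f : V → ℝ} (hf : ∑ v, f v * G.lap f v = 0) (u v : V) : f u = f v := by
  rw [G.sum_mul_lap, Finset.sum_eq_zero_iff_of_nonneg fun e _ => by
    rw [← mul_div_assoc]
    exact div_nonneg (mul_self_nonneg _) (G.len_pos e).le] at hf
  have hstep : ∀ e, f (G.src e) = f (G.tgt e) := fun e => by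
    have := hf e (Finset.mem_univ e)
    rw [← mul_div_assoc, div_eq_zero_iff, mul_self_eq_zero] at this
    exact sub_eq_zero.1 (this.resolve_right (G.len_pos e).ne')
  induction hG.2 u v with
  | rel a b h =>
    obtain ⟨e, rfl, rfl⟩ := h
    exact hstep e
  | refl a => rfl
  | symm a b _ ih => exact ih.symm
  | trans a b c _ _ ih₁ ih₂ => exact ih₁.trans ih₂

/-- The Laplacian has the constants as kernel; a rank-one term that grounds `z` makes it injective
by positivity of the energy, hence invertible in finite dimension. -/
theorem Connected.exists_isGreen [Fintype V] {G : MetricMultigraph V E} (hG : G.Connected)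
    (z : V) : ∃ γ, G.IsGreen (fun v => if v = z then 1 else 0) γ := by
  let T : (V → ℝ) →ₗ[ℝ] (V → ℝ) :=
    { toFun := fun f v => G.lap f v + f z * (if v = z then 1 else 0)
      map_add' := fun f g => by
        funext v
        have := G.lap_add f g v
        simp only [Pi.add_apply]
        rw [show f + g = fun u => f u + g u from rfl, this]
        ring
      map_smul' := fun c f => by
        funext v
        have := G.lap_smul c f v
        simp only [Pi.smul_apply, smul_eq_mul, RingHom.id_apply]
        rw [show c • f = fun u => c * f u from rfl, this]
        ring }
  have hT : ∀ f v, T f v = G.lap f v + f z * (if v = z then 1 else 0) := fun _ _ => rfl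
  have hinj : Function.Injective T := by
    rw [← LinearMap.ker_eq_bot, LinearMap.ker_eq_bot']
    intro f hf
    have h0 : ∑ v, f v * T f v = 0 := by simp [hf]
    have h1 : ∑ v, f v * G.lap f v + f z * f z = 0 := by
      rw [← h0]
      simp [hT, mul_add, Finset.sum_add_distrib]
    have h2 := G.sum_mul_lap_self_nonneg f
    have h3 := mul_self_nonneg (f z)
    have hz : f z = 0 := mul_self_eq_zero.1 (by linarith)
    funext v
    exact (hG.eq_of_energy_eq_zero (f := f) (by linarith) v z).trans hz
  have hsurj := LinearMap.injective_iff_surjective.1 hinj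
  choose F hF using fun y : V => hsurj fun v => if v = y then 1 else 0
  refine ⟨fun u y => F y u, fun y v => ?_⟩
  have hv : ∀ v, G.lap (F y) v + F y z * (if v = z then 1 else 0) = if v = y then 1 else 0 :=
    fun v => congrFun (hF y) v
  -- Summing over the vertices kills the Laplacian: the current escaping at `z` equals the unit
  -- current fed in at `y`.
  have hsum : F y z = 1 := by
    have := Finset.sum_congr (rfl : Finset.univ = Finset.univ) fun v (_ : v ∈ Finset.univ) => hv v
    simpa [Finset.sum_add_distrib, G.sum_lap] using this
  have := hv v
  rw [hsum] at this
  change G.lap (F y) v = _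
  linarith

/-! ### Green functions after subdividing an edge -/

section Subdivide

variable [DecidableEq E]

/-- The fundamental solution on a subdivided graph. -/
def subdivideGreen (G : MetricMultigraph V E) (e : E) (t : ℝ) (γ : V → V → ℝ)
    (a b : Option V) : ℝ :=
  G.interp e t (fun u => G.interp e t (γ u) b) a +
    if a = none ∧ b = none then t * (G.len e - t) / G.len e else 0

/-- The failure of linearity of `f` along `e`. -/
def defect (G : MetricMultigraph V E) (e : E) (t : ℝ) (f : Option V → ℝ) : ℝ :=
  f none - G.interp e t (fun v => f (some v)) none

/-- An affine function along the edge carries no net current out of the new vertex; only the defect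
contributes, through the conductances `1/t` and `1/(L - t)`. -/
theorem lap_subdivide_none (G : MetricMultigraph V E) (e : E) (t : Set.Ioo (0 : ℝ) (G.len e))
    (f : Option V → ℝ) :
    (G.subdivide e t).lap f none =
      G.defect e t f * (G.len e / (t * (G.len e - t))) := by
  have ht := t.2.1
  have hl := G.len_pos e
  have htl : 0 < G.len e - t := sub_pos.2 t.2.2
  have h1 : ∀ e', (if e' = e then (none : Option V) else some (G.tgt e')) = none ↔ e' = e := by
    intro e'; split_ifs with h <;> simp [h]
  simp only [lap, Fintype.sum_option, subdivide, h1]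
  rw [Finset.sum_eq_single e]
  · simp only [defect, interp_none, if_true]
    simp
    field_simp
    ring
  · intro b _ hb
    simp [hb]
  · simp

theorem lap_subdivide_some (G : MetricMultigraph V E) (e : E) (t : Set.Ioo (0 : ℝ) (G.len e))
    (f : Option V → ℝ) (v : V) :
    (G.subdivide e t).lap f (some v) = G.lap (fun v => f (some v)) v -
      G.defect e t f * ((if G.src e = v then 1 / (t : ℝ) else 0) +
        (if G.tgt e = v then 1 / (G.len e - t) else 0)) := by
  have ht := t.2.1
  have hl := G.len_pos e
  have htl : 0 < G.len e - t := sub_pos.2 t.2.2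
  simp only [lap, Fintype.sum_option, subdivide]
  rw [← Finset.add_sum_erase _ _ (Finset.mem_univ e),
    ← Finset.add_sum_erase _ _ (Finset.mem_univ e), ← add_assoc, add_sub_right_comm]
  congr 1
  · simp only [defect, interp_none, if_true, Option.some.injEq]
    simp
    split_ifs <;> field_simp <;> ring
  · refine Finset.sum_congr rfl fun e' he' => ?_
    have := Finset.ne_of_mem_erase he'
    simp [this]

/-- For a pole at the new vertex, interpolation alone would split the unit source between the end
points with weights `1 - t/L` and `t/L`. The diagonal term `t (L - t) / L` is the defect whose
currents cancel these two and place the whole source at the new vertex. -/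
theorem IsGreen.subdivide {G : MetricMultigraph V E} {ρ : V → ℝ} {γ : V → V → ℝ}
    (h : G.IsGreen ρ γ) (e : E) (t : Set.Ioo (0 : ℝ) (G.len e)) :
    (G.subdivide e t).IsGreen (fun o => o.elim 0 ρ) (G.subdivideGreen e t γ) := by
  have ht := t.2.1
  have hl := G.len_pos e
  have htl : 0 < G.len e - t := sub_pos.2 t.2.2
  rintro (_ | y) (_ | v)
  · rw [lap_subdivide_none]
    simp only [defect, subdivideGreen, interp_none, interp_some]
    simp
    field_simp
  · rw [lap_subdivide_some]
    have h1 : G.lap (fun u => G.subdivideGreen e t γ (some u) none) v =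
        (1 - t / G.len e) * G.lap (fun u => γ u (G.src e)) v +
          t / G.len e * G.lap (fun u => γ u (G.tgt e)) v := by
      rw [← lap_smul, ← lap_smul, ← lap_add]
      simp [subdivideGreen]
    rw [h1, h, h]
    simp only [defect, subdivideGreen, interp_none, interp_some, eq_comm (a := v)]
    simp
    split_ifs <;> field_simp <;> ring
  · rw [lap_subdivide_none]
    simp [defect, subdivideGreen]
  · rw [lap_subdivide_some]
    have h1 : G.defect e t (fun u => G.subdivideGreen e t γ u (some y)) = 0 := by
      simp [defect, subdivideGreen]
    rw [h1]
    simpa [subdivideGreen] using h y v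

end Subdivide

end Laplacian

/-! ### Coordinates of points and the extended kernel -/

/-- The barycentric coordinates of a point with respect to the end points of its edge. -/
def bary {V E : Type*} [DecidableEq V] (G : MetricMultigraph V E) : G.Point → V → ℝ
  | Sum.inl u, v => if v = u then 1 else 0
  | Sum.inr ⟨e, t⟩, v => (1 - t / G.len e) * (if v = G.src e then 1 else 0) +
      t / G.len e * (if v = G.tgt e then 1 else 0)

/-- The parameter of a point along the edge `e`, and `0` for the points outside of `e`. -/
def pos {V E : Type*} [DecidableEq E] (G : MetricMultigraph V E) : G.Point → E → ℝ
  | Sum.inl _, _ => 0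
  | Sum.inr ⟨e', t⟩, e => if e = e' then t else 0

/-- A point is a vertex or lies in the interior of an edge. -/
@[elab_as_elim]
theorem Point.cases {V E : Type*} {G : MetricMultigraph V E} {motive : G.Point → Prop}
    (vertex : ∀ v, motive (G.vertex v)) (onEdge : ∀ e t, motive (G.onEdge e t)) (x : G.Point) :
    motive x := by
  rcases x with v | ⟨e, t⟩
  · exact vertex v
  · exact onEdge e t

theorem sum_bary_inl {V E : Type*} [DecidableEq V] [Fintype V] (G : MetricMultigraph V E)
    (u : V) (f : V → ℝ) :
    ∑ v, G.bary (G.vertex u) v * f v = f u := by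
  simp [bary, vertex]

theorem sum_bary_inr {V E : Type*} [DecidableEq V] [Fintype V]
    (G : MetricMultigraph V E) (e : E) (t : Set.Ioo (0 : ℝ) (G.len e))
    (f : V → ℝ) :
    ∑ v, G.bary (G.onEdge e t) v * f v =
      (1 - t / G.len e) * f (G.src e) + t / G.len e * f (G.tgt e) := by
  simp [bary, onEdge, add_mul, Finset.sum_add_distrib]

theorem pos_nonneg {V E : Type*} [DecidableEq E] (G : MetricMultigraph V E) (x : G.Point)
    (e : E) : 0 ≤ G.pos x e := by
  rcases x with u | ⟨e', t⟩
  · exact le_rfl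
  · simp only [pos]
    split_ifs
    · exact t.2.1.le
    · exact le_rfl

section Resistance

variable {V E : Type*} [DecidableEq V] [DecidableEq E] [Fintype V] [Fintype E]

/-- A kernel on the coordinates of the points, extending the kernel `γ` on the vertices. -/
def coordKernel (G : MetricMultigraph V E) (γ : V → V → ℝ) (x y : (V → ℝ) × (E → ℝ)) : ℝ :=
  ∑ u, x.1 u * ∑ v, y.1 v * γ u v +
    ∑ e, min (x.2 e) (y.2 e) * (G.len e - max (x.2 e) (y.2 e)) / G.len e

/-- The coordinates of a point. -/
def coord (G : MetricMultigraph V E) (x : G.Point) : (V → ℝ) × (E → ℝ) := (G.bary x, G.pos x)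

/-- The extension of the kernel `γ` from the vertices to the points. -/
def kernel (G : MetricMultigraph V E) (γ : V → V → ℝ) (x y : G.Point) : ℝ :=
  G.coordKernel γ (G.coord x) (G.coord y)

theorem sum_pos_inl_left {V E : Type*} [DecidableEq E] [Fintype E]
    (G : MetricMultigraph V E) (u : V) (y : G.Point) :
    ∑ e, min (G.pos (G.vertex u) e) (G.pos y e) *
      (G.len e - max (G.pos (G.vertex u) e) (G.pos y e)) / G.len e = 0 := by
  refine Finset.sum_eq_zero fun e _ => ?_
  rw [show G.pos (G.vertex u) e = 0 from rfl, min_eq_left (G.pos_nonneg y e)]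
  simp

theorem sum_pos_inl_right {V E : Type*} [DecidableEq E] [Fintype E]
    (G : MetricMultigraph V E) (u : V) (x : G.Point) :
    ∑ e, min (G.pos x e) (G.pos (G.vertex u) e) *
      (G.len e - max (G.pos x e) (G.pos (G.vertex u) e)) / G.len e = 0 := by
  simpa only [min_comm, max_comm] using G.sum_pos_inl_left u x

theorem sum_pos_inr {V E : Type*} [DecidableEq E] [Fintype E]
    (G : MetricMultigraph V E) (e : E) (t : Set.Ioo (0 : ℝ) (G.len e))
    (y : G.Point) :
    ∑ e', min (G.pos (G.onEdge e t) e') (G.pos y e') *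
      (G.len e' - max (G.pos (G.onEdge e t) e') (G.pos y e')) / G.len e' =
    min (t : ℝ) (G.pos y e) * (G.len e - max (t : ℝ) (G.pos y e)) / G.len e := by
  rw [Finset.sum_eq_single e]
  · simp [pos, onEdge]
  · intro b _ hb
    rw [show G.pos (G.onEdge e t) b = 0 by simp [pos, onEdge, hb], min_eq_left (G.pos_nonneg y b)]
    simp
  · simp

theorem kernel_inl_inl (G : MetricMultigraph V E) (γ : V → V → ℝ) (u v : V) :
    G.kernel γ (G.vertex u) (G.vertex v) = γ u v := by
  simp only [kernel, coordKernel, coord, sum_bary_inl]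
  rw [sum_pos_inl_left, add_zero]

theorem kernel_inl_inr (G : MetricMultigraph V E) (γ : V → V → ℝ) (u : V) (e : E)
    (t : Set.Ioo (0 : ℝ) (G.len e)) :
    G.kernel γ (G.vertex u) (G.onEdge e t) =
      (1 - t / G.len e) * γ u (G.src e) + t / G.len e * γ u (G.tgt e) := by
  simp only [kernel, coordKernel, coord, sum_bary_inl, sum_bary_inr]
  rw [sum_pos_inl_left, add_zero]

theorem kernel_inr_inl (G : MetricMultigraph V E) (γ : V → V → ℝ) (u : V) (e : E)
    (t : Set.Ioo (0 : ℝ) (G.len e)) :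
    G.kernel γ (G.onEdge e t) (G.vertex u) =
      (1 - t / G.len e) * γ (G.src e) u + t / G.len e * γ (G.tgt e) u := by
  simp only [kernel, coordKernel, coord, sum_bary_inl, sum_bary_inr]
  rw [sum_pos_inl_right, add_zero]

theorem kernel_inr_inr (G : MetricMultigraph V E) (γ : V → V → ℝ) (e e' : E)
    (t : Set.Ioo (0 : ℝ) (G.len e)) (s : Set.Ioo (0 : ℝ) (G.len e')) :
    G.kernel γ (G.onEdge e t) (G.onEdge e' s) =
      (1 - t / G.len e) *
          ((1 - s / G.len e') * γ (G.src e) (G.src e') + s / G.len e' * γ (G.src e) (G.tgt e')) +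
        t / G.len e *
          ((1 - s / G.len e') * γ (G.tgt e) (G.src e') + s / G.len e' * γ (G.tgt e) (G.tgt e')) +
      if e = e' then min (t : ℝ) s * (G.len e - max (t : ℝ) s) / G.len e else 0 := by
  simp only [kernel, coordKernel, coord, sum_bary_inr]
  rw [sum_pos_inr]
  congr 1
  simp only [pos, onEdge]
  split_ifs
  · rfl
  · rw [min_eq_right t.2.1.le]
    simp

theorem r_onEdge_of_onEdge {V E : Type*} [DecidableEq V] [DecidableEq E] [Fintype E]
    {G : MetricMultigraph V E} {e : E} {t : Set.Ioo (0 : ℝ) (G.len e)}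
    {y : G.Point} {e' : Option E} {t' : Set.Ioo (0 : ℝ) ((G.subdivide e t).len e')}
    (hy : G.toSubdivide e t y = onEdge _ e' t') :
    G.r (G.onEdge e t) y =
      (((G.subdivide e t).subdivide e' t').effRes (some none) none).toReal := by
  change (match G.toSubdivide e t y with
    | Sum.inl y' => ((G.subdivide e t).effRes none y').toReal
    | Sum.inr ⟨e', t'⟩ =>
      (((G.subdivide e t).subdivide e' t').effRes (some none) none).toReal) = _
  rw [hy]
  rfl

theorem r_onEdge_of_vertex {V E : Type*} [DecidableEq V] [DecidableEq E] [Fintype E]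
    {G : MetricMultigraph V E} {e : E} {t : Set.Ioo (0 : ℝ) (G.len e)}
    {y : G.Point} {y' : Option V} (hy : G.toSubdivide e t y = vertex _ y') :
    G.r (G.onEdge e t) y = ((G.subdivide e t).effRes none y').toReal := by
  change (match G.toSubdivide e t y with
    | Sum.inl y' => ((G.subdivide e t).effRes none y').toReal
    | Sum.inr ⟨e', t'⟩ =>
      (((G.subdivide e t).subdivide e' t').effRes (some none) none).toReal) = _
  rw [hy]
  rfl

/-- The resistance function in terms of a fundamental solution. -/
theorem IsGreen.r_eq {G : MetricMultigraph V E} {ρ : V → ℝ} {γ : V → V → ℝ}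
    (h : G.IsGreen ρ γ) (x y : G.Point) :
    G.r x y = G.kernel γ x x - G.kernel γ x y - G.kernel γ y x + G.kernel γ y y := by
  induction x using Point.cases with
  | vertex x =>
    induction y using Point.cases with
    | vertex y =>
      simp only [kernel_inl_inl]
      exact h.effRes_toReal x y
    | onEdge e' s =>
      refine ((h.subdivide e' s).effRes_toReal (some x) none).trans ?_
      simp only [kernel_inl_inl, kernel_inl_inr, kernel_inr_inl, kernel_inr_inr, subdivideGreen]
      simp
  | onEdge e t =>
    have ht := t.2.1
    have hl := G.len_pos e
    have htl : 0 < G.len e - t := sub_pos.2 t.2.2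
    induction y using Point.cases with
    | vertex y =>
      refine ((h.subdivide e t).effRes_toReal none (some y)).trans ?_
      simp only [kernel_inl_inl, kernel_inl_inr, kernel_inr_inl, kernel_inr_inr, subdivideGreen]
      simp
    | onEdge e' s =>
      have hs := s.2.1
      have hl' := G.len_pos e'
      by_cases he : e' = e
      · subst he
        -- Two points of the same edge: the second lies on the first piece, coincides with the new
        -- vertex, or lies on the second piece with parameter `s - t`.
        rcases lt_trichotomy (s : ℝ) t with hst | hst | hst
        · have hp : G.toSubdivide e' t (G.onEdge e' s) =
              onEdge _ (some e') ⟨s, s.2.1, by simpa [MetricMultigraph.subdivide] using hst⟩ := by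
            simp [toSubdivide, onEdge, hst]
            rfl
          rw [r_onEdge_of_onEdge hp,
            ((h.subdivide e' t).subdivide (some e') _).effRes_toReal (some none) none]
          simp only [kernel_inr_inr, subdivideGreen]
          simp only [MetricMultigraph.subdivide, interp_some, interp_none, subdivideGreen]
          simp [min_eq_right hst.le, max_eq_left hst.le, min_eq_left hst.le, max_eq_right hst.le]
          field_simp
          ring
        · have hst' : s = t := Subtype.ext hst
          subst hst'
          have hp : G.toSubdivide e' s (G.onEdge e' s) = vertex _ none := by
            simp [toSubdivide, onEdge]
          rw [r_onEdge_of_vertex hp, (h.subdivide e' s).effRes_toReal none none]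
          ring
        · have hp : G.toSubdivide e' t (G.onEdge e' s) =
              onEdge _ none ⟨s - t, sub_pos.2 hst, sub_lt_sub_right s.2.2 _⟩ := by
            simp [toSubdivide, onEdge, hst, hst.not_gt]
            rfl
          rw [r_onEdge_of_onEdge hp,
            ((h.subdivide e' t).subdivide none _).effRes_toReal (some none) none]
          simp only [kernel_inr_inr, subdivideGreen]
          simp only [MetricMultigraph.subdivide, interp_some, interp_none, subdivideGreen]
          simp [min_eq_right hst.le, max_eq_left hst.le, min_eq_left hst.le, max_eq_right hst.le]
          field_simp
          ring
      · have hp : G.toSubdivide e t (G.onEdge e' s) = onEdge _ (some e')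
            ⟨s, s.2.1, by simpa [MetricMultigraph.subdivide, he] using s.2.2⟩ := by
          simp [toSubdivide, onEdge, he]
          rfl
        rw [r_onEdge_of_onEdge hp,
          ((h.subdivide e t).subdivide (some e') _).effRes_toReal (some none) none]
        simp only [kernel_inr_inr, subdivideGreen]
        simp only [MetricMultigraph.subdivide, interp_some, interp_none, subdivideGreen]
        simp [he, Ne.symm he]
        ring

end Resistance

/-! ### Measurability and boundedness of the resistance function -/

section Measurability

variable {V E : Type*}

theorem measurable_of_onEdge {α : Type*} [MeasurableSpace α] {G : MetricMultigraph V E}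
    {f : G.Point → α} (hf : ∀ e, Measurable fun t => f (G.onEdge e t)) : Measurable f := by
  let : MeasurableSpace V := ⊤
  refine measurable_fun_sum (f := f) measurable_from_top ?_
  intro s hs
  rw [MeasurableSpace.measurableSet_iInf]
  exact fun e => hf e hs

variable [DecidableEq V] [DecidableEq E] [Fintype V] [Fintype E]

theorem measurable_coord {V E : Type*} [DecidableEq V] [DecidableEq E] (G : MetricMultigraph V E) :
    Measurable G.coord := by
  refine measurable_of_onEdge fun e => Measurable.prodMk ?_ ?_
  · refine measurable_pi_iff.2 fun v => ?_
    change Measurable fun t : Set.Ioo (0 : ℝ) (G.len e) =>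
      (1 - (t : ℝ) / G.len e) * (if v = G.src e then 1 else 0) +
        t / G.len e * (if v = G.tgt e then 1 else 0)
    fun_prop
  · refine measurable_pi_iff.2 fun e' => ?_
    change Measurable fun t : Set.Ioo (0 : ℝ) (G.len e) => if e' = e then (t : ℝ) else 0
    split_ifs <;> fun_prop

theorem coord_mem {V E : Type*} [DecidableEq V] [DecidableEq E] (G : MetricMultigraph V E)
    (x : G.Point) :
    G.coord x ∈ (Set.univ.pi fun _ => Set.Icc 0 1) ×ˢ
      (Set.univ.pi fun e => Set.Icc 0 (G.len e)) := by
  have : ∀ (P : Prop) [Decidable P], (0 : ℝ) ≤ (if P then 1 else 0) ∧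
      (if P then 1 else 0) ≤ (1 : ℝ) := fun P _ => by split_ifs <;> simp
  refine ⟨fun v _ => ?_, fun e _ => ⟨G.pos_nonneg x e, ?_⟩⟩
  · rcases x with u | ⟨e, t⟩
    · exact this _
    · have h0 : 0 ≤ (t : ℝ) / G.len e := div_nonneg t.2.1.le (G.len_pos e).le
      have h1 : (t : ℝ) / G.len e ≤ 1 := (div_le_one (G.len_pos e)).2 t.2.2.le
      have ha := this (v = G.src e)
      have hb := this (v = G.tgt e)
      change _ ≤ _ * _ + _ * _ ∧ _ * _ + _ * _ ≤ _
      constructor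
      · have := mul_nonneg (sub_nonneg.2 h1) ha.1
        have := mul_nonneg h0 hb.1
        linarith
      · have := mul_le_mul_of_nonneg_left ha.2 (sub_nonneg.2 h1)
        have := mul_le_mul_of_nonneg_left hb.2 h0
        linarith
  · rcases x with u | ⟨e', t⟩
    · exact (G.len_pos e).le
    · change (if e = e' then (t : ℝ) else 0) ≤ _
      split_ifs with he
      · subst he
        exact t.2.2.le
      · exact (G.len_pos e).le

theorem continuous_coordKernel {V E : Type*} [Fintype V] [Fintype E]
    (G : MetricMultigraph V E) (γ : V → V → ℝ) :
    Continuous fun z : ((V → ℝ) × (E → ℝ)) × ((V → ℝ) × (E → ℝ)) =>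
      G.coordKernel γ z.1 z.2 := by
  unfold coordKernel
  fun_prop

/-- By `IsGreen.r_eq`, the resistance is a combination of values of a continuous function of
measurable coordinates; these coordinates stay in a compact box, which also gives the bound below.
-/
theorem Connected.measurable_r {G : MetricMultigraph V E} (hG : G.Connected) :
    Measurable fun z : G.Point × G.Point => G.r z.1 z.2 := by
  obtain ⟨γ, h⟩ := hG.exists_isGreen hG.1.some
  simp only [h.r_eq]
  have hk : ∀ a b : G.Point × G.Point → G.Point, Measurable a → Measurable b →
      Measurable fun z => G.kernel γ (a z) (b z) := fun a b ha hb =>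
    (G.continuous_coordKernel γ).measurable.comp
      ((G.measurable_coord.comp ha).prodMk (G.measurable_coord.comp hb))
  exact (((hk _ _ measurable_fst measurable_fst).sub (hk _ _ measurable_fst measurable_snd)).sub
    (hk _ _ measurable_snd measurable_fst)).add (hk _ _ measurable_snd measurable_snd)

theorem Connected.exists_bound_r {G : MetricMultigraph V E} (hG : G.Connected) :
    ∃ C, ∀ x y, ‖G.r x y‖ ≤ C := by
  obtain ⟨γ, h⟩ := hG.exists_isGreen hG.1.some
  let B : Set ((V → ℝ) × (E → ℝ)) :=
    (Set.univ.pi fun _ => Set.Icc 0 1) ×ˢ (Set.univ.pi fun e => Set.Icc 0 (G.len e))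
  have hB : IsCompact B :=
    (isCompact_univ_pi fun _ => isCompact_Icc).prod (isCompact_univ_pi fun _ => isCompact_Icc)
  obtain ⟨C, hC⟩ := (hB.prod hB).exists_bound_of_continuousOn
    (G.continuous_coordKernel γ).continuousOn
  have hk : ∀ x y : G.Point, ‖G.kernel γ x y‖ ≤ C := fun x y =>
    hC (G.coord x, G.coord y) ⟨G.coord_mem x, G.coord_mem y⟩
  refine ⟨C + C + C + C, fun x y => ?_⟩
  rw [h.r_eq]
  refine (norm_add_le _ _).trans (add_le_add ((norm_sub_le _ _).trans (add_le_add
    ((norm_sub_le _ _).trans (add_le_add ?_ ?_)) ?_)) ?_) <;> exact hk _ _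

end Measurability

/-! ### Edge deletion, edge resistances and Foster's theorem -/

section Deletion

variable {V E : Type*} [DecidableEq V] [DecidableEq E] [Fintype E]

theorem lap_deleteEdge (G : MetricMultigraph V E) (e : E) (f : V → ℝ) (v : V) :
    (G.deleteEdge e).lap f v = G.lap f v -
      ((if G.src e = v then 1 else 0) - (if G.tgt e = v then 1 else 0)) *
        ((f (G.src e) - f (G.tgt e)) / G.len e) := by
  rw [eq_sub_iff_add_eq']
  exact (Fintype.sum_eq_add_sum_subtype_ne
    (fun e => ((if G.src e = v then 1 else 0) - (if G.tgt e = v then 1 else 0)) *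
      ((f (G.src e) - f (G.tgt e)) / G.len e)) e).symm

theorem lap_deleteEdge_loop {G : MetricMultigraph V E} {e : E} (he : G.src e = G.tgt e)
    (f : V → ℝ) (v : V) : (G.deleteEdge e).lap f v = G.lap f v := by
  simp [lap_deleteEdge, he]

/-- Resistances see only the Laplacian, so graphs with different edge sets can be compared. -/
theorem effRes_congr {V E E' : Type*} [DecidableEq V] [Fintype E] [Fintype E']
    {G : MetricMultigraph V E}
    {H : MetricMultigraph V E'} (h : ∀ f v, G.lap f v = H.lap f v) (x y : V) :
    G.effRes x y = H.effRes x y := by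
  simp only [effRes, isPotential_iff, h]

theorem edgeRes_deleteEdge_loop {G : MetricMultigraph V E} {e : E} (he : G.src e = G.tgt e)
    (e' : {e' : E // e' ≠ e}) : (G.deleteEdge e).edgeRes e' = G.edgeRes e' := by
  refine effRes_congr (fun f v => ?_) _ _
  rw [lap_deleteEdge (G.deleteEdge e), lap_deleteEdge_loop he, lap_deleteEdge]
  rfl

theorem edgeRes_loop [Fintype V] {G : MetricMultigraph V E} {e : E} (he : G.src e = G.tgt e) :
    G.edgeRes e = 0 := by
  have h : (G.deleteEdge e).IsPotential (G.src e) (G.tgt e) fun _ => 0 := by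
    rw [isPotential_iff]
    simp [lap, he]
  rw [edgeRes, effRes_eq h]
  simp

/-- The mass of an edge for the canonical measure, through the resistance of the whole graph. -/
theorem IsGreen.edge_mass [Fintype V] {G : MetricMultigraph V E} {ρ : V → ℝ} {γ : V → V → ℝ}
    (h : G.IsGreen ρ γ) (e : E) :
    ((ENNReal.ofReal (G.len e) + G.edgeRes e)⁻¹).toReal * G.len e =
      1 - (γ (G.src e) (G.src e) - γ (G.src e) (G.tgt e) - γ (G.tgt e) (G.src e) +
        γ (G.tgt e) (G.tgt e)) / G.len e := by
  have hl := G.len_pos e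
  -- `d` is the resistance between the ends of `e` in the whole graph, so `d / L` is the share of a
  -- unit current that flows through `e`.
  set d := γ (G.src e) (G.src e) - γ (G.src e) (G.tgt e) - γ (G.tgt e) (G.src e) +
    γ (G.tgt e) (G.tgt e) with hd
  let f : V → ℝ := fun u => γ u (G.tgt e) - γ u (G.src e)
  have hdf : f (G.tgt e) - f (G.src e) = d := by simp only [f, hd]; ring
  have hf : ∀ v, (G.deleteEdge e).lap f v =
      ((if v = G.tgt e then 1 else 0) - (if v = G.src e then 1 else 0)) * (1 - d / G.len e) := by
    intro v
    rw [lap_deleteEdge, (isPotential_iff _ _ _ _).1 (h.isPotential (G.src e) (G.tgt e)) v, ← hdf]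
    simp only [eq_comm (a := v)]
    ring
  -- Bridge case: all the current uses `e`, so `f` is harmonic after deletion. Pairing it with a
  -- potential for the deleted graph would force `d = 0`, against `d = L`. Otherwise rescaling `f`
  -- gives such a potential, and `R = d / (1 - d/L)`.
  by_cases hc : 1 - d / G.len e = 0
  · have htop : G.edgeRes e = ⊤ := by
      refine iInf₂_eq_top.2 fun b hb => ?_
      have h1 := hb.sum_mul_lap f
      have h2 : ∑ v, b v * (G.deleteEdge e).lap f v = 0 := by simp [hf, hc]
      rw [sum_mul_lap_comm, h2, hdf] at h1
      simp [← h1] at hc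
    simp [htop, hc]
  · have hpot : (G.deleteEdge e).IsPotential (G.src e) (G.tgt e)
        fun u => (1 - d / G.len e)⁻¹ * f u := by
      rw [isPotential_iff]
      intro v
      rw [lap_smul, hf, mul_left_comm, inv_mul_cancel₀ hc, mul_one]
    have hnn := hpot.drop_nonneg
    rw [edgeRes, effRes_eq hpot, ← ENNReal.ofReal_add hl.le hnn, ENNReal.toReal_inv,
      ENNReal.toReal_ofReal (by linarith)]
    rw [← mul_sub, hdf] at hnn ⊢
    have hsum : G.len e + (1 - d / G.len e)⁻¹ * d = G.len e * (1 - d / G.len e)⁻¹ := by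
      have hd' : d = G.len e * (1 - (1 - d / G.len e)) := by field_simp; ring
      nth_rewrite 2 [hd']
      rw [mul_left_comm, mul_sub, inv_mul_cancel₀ hc]
      ring
    rw [hsum, mul_inv, inv_inv]
    field_simp

/-- Foster's theorem. -/
theorem Connected.sum_edge_mass [Fintype V] {G : MetricMultigraph V E} (hG : G.Connected) :
    ∑ e, ((ENNReal.ofReal (G.len e) + G.edgeRes e)⁻¹).toReal * G.len e =
      Fintype.card E - Fintype.card V + 1 := by
  obtain ⟨γ, h⟩ := hG.exists_isGreen hG.1.some
  -- The trace of the Laplacian applied to γ is evaluated twice: from the Green equation, where ρ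
  -- has total mass one, and edge by edge.
  have htr : ∑ y, G.lap (fun u => γ u y) y = Fintype.card V - 1 := by
    simp [h _ _, Finset.sum_sub_distrib]
  have htr' : ∑ y, G.lap (fun u => γ u y) y =
      ∑ e, (γ (G.src e) (G.src e) - γ (G.src e) (G.tgt e) - γ (G.tgt e) (G.src e) +
        γ (G.tgt e) (G.tgt e)) / G.len e := by
    simp only [lap]
    rw [Finset.sum_comm]
    refine Finset.sum_congr rfl fun e _ => ?_
    simp only [sub_mul, Finset.sum_sub_distrib, ite_mul, one_mul, zero_mul, Finset.sum_ite_eq,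
      Finset.mem_univ, if_true]
    ring
  simp only [h.edge_mass, Finset.sum_sub_distrib, ← htr', htr]
  simp
  ring

end Deletion

/-! ### Integration against the admissible measure and the canonical divisor -/

section Integration

variable {V E : Type*} [DecidableEq V] [DecidableEq E] [Fintype V] [Fintype E]

/-- Lebesgue measure on the parameters of the interior points of `e`. -/
abbrev paramMeasure {V E : Type*} (G : MetricMultigraph V E) (e : E) :
    Measure (Set.Ioo (0 : ℝ) (G.len e)) :=
  (volume : Measure ℝ).comap (↑)

theorem paramMeasure_univ {V E : Type*} (G : MetricMultigraph V E) (e : E) :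
    G.paramMeasure e Set.univ = ENNReal.ofReal (G.len e) := by
  rw [paramMeasure, comap_subtype_coe_apply measurableSet_Ioo, Set.image_univ,
    Subtype.range_coe, Real.volume_Ioo, sub_zero]

instance {V E : Type*} (G : MetricMultigraph V E) (e : E) : IsFiniteMeasure (G.paramMeasure e) :=
  ⟨by simp [paramMeasure_univ]⟩

instance {V E : Type*} (G : MetricMultigraph V E) (e : E) : IsFiniteMeasure (G.edgeMeasure e) := by
  unfold edgeMeasure
  infer_instance

theorem edge_weight_ne_top {V E : Type*} [DecidableEq V] [DecidableEq E] [Fintype E]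
    (G : MetricMultigraph V E) (e : E) :
    (ENNReal.ofReal (G.len e) + G.edgeRes e)⁻¹ ≠ ⊤ := by
  simp [G.len_pos e]

theorem isFiniteMeasure_muAd {G : MetricMultigraph V E} {q : V → ℕ} (hg : 0 < G.genus q) :
    IsFiniteMeasure (G.muAd q) := by
  have h1 : IsFiniteMeasure (∑ p, (q p : ℝ≥0∞) • Measure.dirac (G.vertex p)) := by
    refine ⟨?_⟩
    simp [Measure.finsetSum_apply]
  have h2 : IsFiniteMeasure
      (∑ e, (ENNReal.ofReal (G.len e) + G.edgeRes e)⁻¹ • G.edgeMeasure e) := by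
    refine ⟨?_⟩
    rw [Measure.finsetSum_apply]
    exact ENNReal.sum_lt_top.2 fun e _ =>
      ENNReal.mul_lt_top (G.edge_weight_ne_top e).lt_top (measure_lt_top _ _)
  refine Measure.smul_finite _ ?_
  simpa using hg

theorem integral_muAd {G : MetricMultigraph V E} {q : V → ℕ} (hg : 0 < G.genus q)
    {F : G.Point → ℝ} (hF : Measurable F) {C : ℝ} (hC : ∀ x, ‖F x‖ ≤ C) :
    ∫ x, F x ∂G.muAd q = (G.genus q : ℝ)⁻¹ * (∑ p, q p * F (G.vertex p) +
      ∑ e, ((ENNReal.ofReal (G.len e) + G.edgeRes e)⁻¹).toReal *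
        ∫ t, F (G.onEdge e t) ∂G.paramMeasure e) := by
  have hint : ∀ (μ : Measure G.Point) [IsFiniteMeasure μ], Integrable F μ := fun μ _ =>
    Integrable.of_bound hF.aestronglyMeasurable C (ae_of_all _ hC)
  have h1 : ∀ p, Integrable F ((q p : ℝ≥0∞) • Measure.dirac (G.vertex p)) := fun p =>
    (hint _).smul_measure (by simp)
  have h2 : ∀ e, Integrable F ((ENNReal.ofReal (G.len e) + G.edgeRes e)⁻¹ • G.edgeMeasure e) :=
    fun e => (hint _).smul_measure (G.edge_weight_ne_top e)
  have hg' : (0 : ℝ) ≤ G.genus q := by exact_mod_cast hg.le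
  rw [muAd, integral_smul_measure, integral_add_measure (integrable_finsetSum_measure.2
    fun p _ => h1 p) (integrable_finsetSum_measure.2 fun e _ => h2 e),
    integral_finsetSum_measure fun p _ => h1 p, integral_finsetSum_measure fun e _ => h2 e,
    ENNReal.toReal_inv, ENNReal.toReal_ofReal hg', smul_eq_mul]
  congr 2
  · refine Finset.sum_congr rfl fun p _ => ?_
    rw [integral_smul_measure, integral_dirac' _ _ hF.stronglyMeasurable]
    simp
  · refine Finset.sum_congr rfl fun e _ => ?_
    rw [integral_smul_measure, edgeMeasure,
      integral_map (G.measurable_onEdge e).aemeasurable hF.aestronglyMeasurable, smul_eq_mul]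

theorem integral_deltaK {V E : Type*} [DecidableEq V] [Fintype V] [Fintype E]
    {G : MetricMultigraph V E} {q : V → ℕ} (hK : ∀ p, 0 ≤ G.K q p)
    {F : G.Point → ℝ} (hF : Measurable F) {C : ℝ} (hC : ∀ x, ‖F x‖ ≤ C) :
    ∫ x, F x ∂G.deltaK q = ∑ p, G.K q p * F (G.vertex p) := by
  have h1 : ∀ p, Integrable F (ENNReal.ofReal (G.K q p : ℝ) • Measure.dirac (G.vertex p)) :=
    fun p => (Integrable.of_bound hF.aestronglyMeasurable C (ae_of_all _ hC)).smul_measure (by simp)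
  rw [deltaK, integral_finsetSum_measure fun p _ => h1 p]
  refine Finset.sum_congr rfl fun p _ => ?_
  rw [integral_smul_measure, integral_dirac' _ _ hF.stronglyMeasurable,
    ENNReal.toReal_ofReal (by exact_mod_cast hK p), smul_eq_mul]

/-- By Foster's theorem the edges contribute the first Betti number, which together with the sum of
`q` is the genus; so μ_ad has mass one. -/
theorem integral_const_muAd {G : MetricMultigraph V E} {q : V → ℕ} (hG : G.Connected)
    (hg : 0 < G.genus q) (c : ℝ) : ∫ _, c ∂G.muAd q = c := by
  rw [integral_muAd hg measurable_const (C := ‖c‖) fun _ => le_rfl]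
  have hm : ∀ e, ∫ _, c ∂G.paramMeasure e = G.len e * c := fun e => by
    rw [integral_const, Measure.real, paramMeasure_univ, ENNReal.toReal_ofReal (G.len_pos e).le,
      smul_eq_mul]
  have hg' : (G.genus q : ℝ) ≠ 0 := by exact_mod_cast hg.ne'
  simp only [hm, ← mul_assoc, ← Finset.sum_mul]
  rw [hG.sum_edge_mass, ← add_mul, inv_mul_eq_div, div_eq_iff hg', mul_comm c]
  congr 1
  simp only [genus]
  push_cast
  ring

theorem sum_valence {V E : Type*} [DecidableEq V] [Fintype V] [Fintype E]
    (G : MetricMultigraph V E) : ∑ p, G.valence p = 2 * Fintype.card E := by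
  simp only [valence, Finset.card_filter, Finset.sum_add_distrib]
  rw [Finset.sum_comm, Finset.sum_comm (γ := V)]
  simp [two_mul]

theorem sum_K {V E : Type*} [DecidableEq V] [Fintype V] [Fintype E]
    (G : MetricMultigraph V E) (q : V → ℕ) :
    ∑ p, G.K q p = 2 * G.genus q - 2 := by
  simp only [K, genus, Finset.sum_add_distrib, Finset.sum_sub_distrib, ← Finset.mul_sum,
    ← Nat.cast_sum, sum_valence]
  simp
  ring

/-- An effective `K` has degree `2g - 2 ≥ 0`. Positivity is what makes the normalization `1/g`
meaningful. -/
theorem IsPMGraph.genus_pos {V E : Type*} [DecidableEq V] [Fintype V] [Fintype E]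
    {G : MetricMultigraph V E} {q : V → ℕ} (h : G.IsPMGraph q) :
    0 < G.genus q := by
  have h1 : 0 ≤ ∑ p, G.K q p := Finset.sum_nonneg fun p _ => h.2 p
  rw [sum_K] at h1
  lia

theorem Connected.measurable_r_right {G : MetricMultigraph V E} (hG : G.Connected) (x : G.Point) :
    Measurable (G.r x) :=
  hG.measurable_r.comp measurable_prodMk_left

theorem IsPMGraph.measurable_integral_r {G : MetricMultigraph V E} {q : V → ℕ}
    (h : G.IsPMGraph q) : Measurable fun x => ∫ y, G.r x y ∂G.muAd q := by
  have := isFiniteMeasure_muAd h.genus_pos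
  exact (h.1.measurable_r.stronglyMeasurable.integral_prod_right' (ν := G.muAd q)).measurable

theorem IsPMGraph.exists_bound_integral_r {G : MetricMultigraph V E} {q : V → ℕ}
    (h : G.IsPMGraph q) : ∃ C, ∀ x, ‖∫ y, G.r x y ∂G.muAd q‖ ≤ C := by
  have := isFiniteMeasure_muAd h.genus_pos
  obtain ⟨C, hC⟩ := h.1.exists_bound_r
  exact ⟨_, fun x => norm_integral_le_of_norm_le_const (ae_of_all _ (hC x))⟩

end Integration

/-! ### Deleting a self-loop: resistances, measures and invariants -/

/-- The inclusion of the points which do not lie in the interior of a deleted edge. -/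
def ofDeleteEdge {V E : Type*} (G : MetricMultigraph V E) (e : E) :
    (G.deleteEdge e).Point → G.Point
  | Sum.inl v => G.vertex v
  | Sum.inr ⟨e', t⟩ => G.onEdge e' t

theorem measurable_ofDeleteEdge {V E : Type*} (G : MetricMultigraph V E) (e : E) :
    Measurable (G.ofDeleteEdge e) :=
  measurable_of_onEdge fun e' => G.measurable_onEdge e'

theorem ofDeleteEdge_vertex {V E : Type*} (G : MetricMultigraph V E) (e : E) (v : V) :
    G.ofDeleteEdge e ((G.deleteEdge e).vertex v) = G.vertex v := rfl

theorem lt_len_of_deleteEdge {V E : Type*} {G : MetricMultigraph V E} {e : E}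
    {e' : {e' : E // e' ≠ e}} (t : Set.Ioo (0 : ℝ) ((G.deleteEdge e).len e')) :
    (t : ℝ) < G.len e' :=
  t.2.2

theorem ofDeleteEdge_onEdge {V E : Type*} (G : MetricMultigraph V E) (e : E)
    (e' : {e' : E // e' ≠ e}) (t : Set.Ioo (0 : ℝ) ((G.deleteEdge e).len e')) :
    G.ofDeleteEdge e ((G.deleteEdge e).onEdge e' t) =
      G.onEdge e' ⟨t, t.2.1, lt_len_of_deleteEdge t⟩ := rfl

section Loop

variable {V E : Type*} [DecidableEq V] [DecidableEq E] [Fintype V] [Fintype E]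

theorem valence_deleteEdge_loop {V E : Type*} [DecidableEq V] [DecidableEq E] [Fintype E]
    {G : MetricMultigraph V E} {e : E} (he : G.src e = G.tgt e) (v : V) :
    G.valence v = (G.deleteEdge e).valence v + if v = G.src e then 2 else 0 := by
  simp only [valence, Finset.card_filter]
  have h1 : ∑ e', (if G.src e' = v then 1 else 0) = (if G.src e = v then 1 else 0) +
      ∑ e', (if (G.deleteEdge e).src e' = v then 1 else 0) :=
    Fintype.sum_eq_add_sum_subtype_ne (fun e => if G.src e = v then 1 else 0) e
  have h2 : ∑ e', (if G.tgt e' = v then 1 else 0) = (if G.src e = v then 1 else 0) +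
      ∑ e', (if (G.deleteEdge e).tgt e' = v then 1 else 0) := by
    rw [he]
    exact Fintype.sum_eq_add_sum_subtype_ne (fun e => if G.tgt e = v then 1 else 0) e
  rw [h1, h2]
  simp only [eq_comm (a := v)]
  split_ifs <;> ring

theorem K_deleteEdge_loop {V E : Type*} [DecidableEq V] [DecidableEq E] [Fintype E]
    {G : MetricMultigraph V E} {e : E} (he : G.src e = G.tgt e) (q : V → ℕ) (v : V) :
    (G.deleteEdge e).K (Function.update q (G.src e) (q (G.src e) + 1)) v = G.K q v := by
  simp only [K, valence_deleteEdge_loop he v, Function.update_apply]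
  split_ifs with h
  · subst h
    push_cast
    ring
  · simp

theorem genus_deleteEdge (G : MetricMultigraph V E) (e : E) (q : V → ℕ) (p : V) :
    (G.deleteEdge e).genus (Function.update q p (q p + 1)) = G.genus q := by
  have h1 : Fintype.card E = 1 + Fintype.card {e' : E // e' ≠ e} := by
    have := Fintype.card_pos_iff.2 ⟨e⟩
    simp
    lia
  have h2 : ∑ v, ((Function.update q p (q p + 1) v : ℕ) : ℤ) = ∑ v, (q v : ℤ) + 1 := by
    rw [← Finset.add_sum_erase _ _ (Finset.mem_univ p),
      ← Finset.add_sum_erase _ (fun v => (q v : ℤ)) (Finset.mem_univ p)]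
    rw [Finset.sum_congr rfl fun v hv => by
      rw [Function.update_of_ne (Finset.ne_of_mem_erase hv)]]
    simp
    ring
  simp only [genus, h2, h1]
  push_cast
  ring

theorem Connected.deleteEdge_loop {V E : Type*} {G : MetricMultigraph V E} (hG : G.Connected)
    {e : E} (he : G.src e = G.tgt e) : (G.deleteEdge e).Connected := by
  refine ⟨hG.1, fun u v => ?_⟩
  induction hG.2 u v with
  | rel a b h =>
    obtain ⟨e', rfl, rfl⟩ := h
    by_cases hee : e' = e
    · subst hee
      rw [he]
      exact .refl _
    · exact .rel _ _ ⟨⟨e', hee⟩, rfl, rfl⟩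
  | refl a => exact .refl a
  | symm a b _ ih => exact ih.symm
  | trans a b c _ _ ih₁ ih₂ => exact ih₁.trans _ _ _ ih₂

theorem IsPMGraph.deleteEdge_loop {V E : Type*} [DecidableEq V] [DecidableEq E] [Fintype E]
    {G : MetricMultigraph V E} {q : V → ℕ} (hG : G.IsPMGraph q)
    {e : E} (he : G.src e = G.tgt e) :
    (G.deleteEdge e).IsPMGraph (Function.update q (G.src e) (q (G.src e) + 1)) :=
  ⟨hG.1.deleteEdge_loop he, fun v => by rw [K_deleteEdge_loop he]; exact hG.2 v⟩

theorem totalLength_deleteEdge {V E : Type*} [DecidableEq E] [Fintype E]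
    (G : MetricMultigraph V E) (e : E) :
    G.totalLength = G.len e + (G.deleteEdge e).totalLength :=
  Fintype.sum_eq_add_sum_subtype_ne G.len e

theorem IsGreen.deleteEdge_loop {V E : Type*} [DecidableEq V] [DecidableEq E] [Fintype E]
    {G : MetricMultigraph V E} {e : E} (he : G.src e = G.tgt e)
    {ρ : V → ℝ} {γ : V → V → ℝ} (h : G.IsGreen ρ γ) : (G.deleteEdge e).IsGreen ρ γ := fun y v => by
  rw [lap_deleteEdge_loop he, h]

theorem kernel_ofDeleteEdge (G : MetricMultigraph V E) (e : E) (γ : V → V → ℝ)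
    (x y : (G.deleteEdge e).Point) :
    G.kernel γ (G.ofDeleteEdge e x) (G.ofDeleteEdge e y) = (G.deleteEdge e).kernel γ x y := by
  induction x using Point.cases with
  | vertex u =>
    induction y using Point.cases with
    | vertex v => rw [ofDeleteEdge_vertex, ofDeleteEdge_vertex, kernel_inl_inl, kernel_inl_inl]
    | onEdge e' t =>
      rw [ofDeleteEdge_vertex, ofDeleteEdge_onEdge, kernel_inl_inr, kernel_inl_inr]
      rfl
  | onEdge e₁ s =>
    induction y using Point.cases with
    | vertex v =>
      rw [ofDeleteEdge_vertex, ofDeleteEdge_onEdge, kernel_inr_inl, kernel_inr_inl]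
      rfl
    | onEdge e₂ t =>
      rw [ofDeleteEdge_onEdge, ofDeleteEdge_onEdge, kernel_inr_inr, kernel_inr_inr]
      simp only [Subtype.ext_iff]
      rfl

/-- Interpolation along a loop is between equal values, so seen from outside the loop every loop
point looks like its base vertex. -/
theorem kernel_ofDeleteEdge_loop {G : MetricMultigraph V E} {e : E} (he : G.src e = G.tgt e)
    (γ : V → V → ℝ) (x : (G.deleteEdge e).Point) (t : Set.Ioo (0 : ℝ) (G.len e)) :
    G.kernel γ (G.ofDeleteEdge e x) (G.onEdge e t) =
      G.kernel γ (G.ofDeleteEdge e x) (G.vertex (G.src e)) := by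
  induction x using Point.cases with
  | vertex u =>
    rw [ofDeleteEdge_vertex, kernel_inl_inr, kernel_inl_inl, ← he]
    ring
  | onEdge e₁ s =>
    rw [ofDeleteEdge_onEdge, kernel_inr_inr, kernel_inr_inl, ← he, if_neg e₁.2]
    ring

theorem kernel_loop_ofDeleteEdge {G : MetricMultigraph V E} {e : E} (he : G.src e = G.tgt e)
    (γ : V → V → ℝ) (x : (G.deleteEdge e).Point) (t : Set.Ioo (0 : ℝ) (G.len e)) :
    G.kernel γ (G.onEdge e t) (G.ofDeleteEdge e x) =
      G.kernel γ (G.vertex (G.src e)) (G.ofDeleteEdge e x) := by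
  induction x using Point.cases with
  | vertex u =>
    rw [ofDeleteEdge_vertex, kernel_inr_inl, kernel_inl_inl, ← he]
    ring
  | onEdge e₁ s =>
    rw [ofDeleteEdge_onEdge, kernel_inr_inr, kernel_inl_inr, ← he, if_neg e₁.2.symm]
    ring

theorem kernel_loop_loop {G : MetricMultigraph V E} {e : E} (he : G.src e = G.tgt e)
    (γ : V → V → ℝ) (s t : Set.Ioo (0 : ℝ) (G.len e)) :
    G.kernel γ (G.onEdge e s) (G.onEdge e t) =
      G.kernel γ (G.vertex (G.src e)) (G.vertex (G.src e)) +
        min (s : ℝ) t * (G.len e - max (s : ℝ) t) / G.len e := by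
  rw [kernel_inr_inr, kernel_inl_inl, ← he, if_pos rfl]
  ring

theorem Connected.r_ofDeleteEdge {G : MetricMultigraph V E} (hG : G.Connected) {e : E}
    (he : G.src e = G.tgt e) (x y : (G.deleteEdge e).Point) :
    G.r (G.ofDeleteEdge e x) (G.ofDeleteEdge e y) = (G.deleteEdge e).r x y := by
  obtain ⟨γ, h⟩ := hG.exists_isGreen hG.1.some
  simp only [h.r_eq, (h.deleteEdge_loop he).r_eq, kernel_ofDeleteEdge]

theorem Connected.r_ofDeleteEdge_loop {G : MetricMultigraph V E} (hG : G.Connected) {e : E}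
    (he : G.src e = G.tgt e) (x : (G.deleteEdge e).Point) (t : Set.Ioo (0 : ℝ) (G.len e)) :
    G.r (G.ofDeleteEdge e x) (G.onEdge e t) =
      G.r (G.ofDeleteEdge e x) (G.vertex (G.src e)) + t * (G.len e - t) / G.len e := by
  obtain ⟨γ, h⟩ := hG.exists_isGreen hG.1.some
  simp only [h.r_eq, kernel_ofDeleteEdge_loop he, kernel_loop_ofDeleteEdge he,
    kernel_loop_loop he, min_self, max_self]
  ring

theorem Connected.r_loop_ofDeleteEdge {G : MetricMultigraph V E} (hG : G.Connected) {e : E}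
    (he : G.src e = G.tgt e) (x : (G.deleteEdge e).Point) (t : Set.Ioo (0 : ℝ) (G.len e)) :
    G.r (G.onEdge e t) (G.ofDeleteEdge e x) =
      G.r (G.vertex (G.src e)) (G.ofDeleteEdge e x) + t * (G.len e - t) / G.len e := by
  obtain ⟨γ, h⟩ := hG.exists_isGreen hG.1.some
  simp only [h.r_eq, kernel_ofDeleteEdge_loop he, kernel_loop_ofDeleteEdge he,
    kernel_loop_loop he, min_self, max_self]
  ring

/-- The vertex part of the kernel is constant on the loop and cancels, leaving the two arcs of a
circle as resistors in parallel. -/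
theorem Connected.r_loop_loop {G : MetricMultigraph V E} (hG : G.Connected) {e : E}
    (he : G.src e = G.tgt e) (s t : Set.Ioo (0 : ℝ) (G.len e)) :
    G.r (G.onEdge e s) (G.onEdge e t) =
      |(s : ℝ) - t| * (G.len e - |(s : ℝ) - t|) / G.len e := by
  obtain ⟨γ, h⟩ := hG.exists_isGreen hG.1.some
  simp only [h.r_eq, kernel_loop_loop he, min_self, max_self]
  rcases le_total (s : ℝ) t with hst | hst
  · rw [min_eq_left hst, max_eq_right hst, min_eq_right hst, max_eq_left hst,
      abs_of_nonpos (sub_nonpos.2 hst)]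
    ring
  · rw [min_eq_right hst, max_eq_left hst, min_eq_left hst, max_eq_right hst,
      abs_of_nonneg (sub_nonneg.2 hst)]
    ring

theorem Connected.r_vertex_self {G : MetricMultigraph V E} (hG : G.Connected) (v : V) :
    G.r (G.vertex v) (G.vertex v) = 0 := by
  obtain ⟨γ, h⟩ := hG.exists_isGreen hG.1.some
  rw [h.r_eq]
  ring

theorem integral_paramMeasure {V E : Type*} (G : MetricMultigraph V E) (e : E) (f : ℝ → ℝ) :
    ∫ t, f t ∂G.paramMeasure e = ∫ t in (0 : ℝ)..G.len e, f t := by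
  rw [intervalIntegral.integral_of_le (G.len_pos e).le, integral_Ioc_eq_integral_Ioo]
  exact integral_subtype_comap measurableSet_Ioo f

theorem integral_loop_parabola {V E : Type*} (G : MetricMultigraph V E) (e : E) :
    ∫ t, (t : ℝ) * (G.len e - t) / G.len e ∂G.paramMeasure e = G.len e ^ 2 / 6 := by
  rw [G.integral_paramMeasure e fun t => t * (G.len e - t) / G.len e]
  have hl := (G.len_pos e).ne'
  have h : ∀ t ∈ Set.uIcc 0 (G.len e), HasDerivAt
      (fun t => (G.len e * t ^ 2 / 2 - t ^ 3 / 3) / G.len e) (t * (G.len e - t) / G.len e) t := by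
    intro t _
    have := ((((hasDerivAt_pow 2 t).const_mul (G.len e)).div_const 2).sub
      ((hasDerivAt_pow 3 t).div_const 3)).div_const (G.len e)
    refine this.congr_deriv ?_
    simp
    ring
  rw [intervalIntegral.integral_eq_sub_of_hasDerivAt h
    (Continuous.intervalIntegrable (by fun_prop) _ _)]
  field_simp
  ring

/-- The value does not depend on `s` because a circle is homogeneous. -/
theorem integral_loop_abs {V E : Type*} (G : MetricMultigraph V E) (e : E)
    (s : Set.Ioo (0 : ℝ) (G.len e)) :
    ∫ t, |(s : ℝ) - t| * (G.len e - |(s : ℝ) - t|) / G.len e ∂G.paramMeasure e =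
      G.len e ^ 2 / 6 := by
  rw [G.integral_paramMeasure e fun t => |(s : ℝ) - t| * (G.len e - |(s : ℝ) - t|) / G.len e]
  have hl := (G.len_pos e).ne'
  -- One antiderivative serves both sides of `s`: `c = -1` before it and `c = 1` after it, where `c
  -- (t - s)` is the absolute value.
  have h : ∀ c t : ℝ, HasDerivAt
      (fun t => (c * G.len e * (t - s) ^ 2 / 2 - (t - s) ^ 3 / 3) / G.len e)
      ((c * (t - s) * G.len e - (t - s) ^ 2) / G.len e) t := by
    intro c t
    have h0 := (hasDerivAt_id t).sub_const (s : ℝ)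
    have := ((((h0.pow 2).const_mul (c * G.len e)).div_const 2).sub
      ((h0.pow 3).div_const 3)).div_const (G.len e)
    refine this.congr_deriv ?_
    simp
    ring
  have hcont : Continuous fun t : ℝ =>
    |(s : ℝ) - t| * (G.len e - |(s : ℝ) - t|) / G.len e := by fun_prop
  rw [← intervalIntegral.integral_add_adjacent_intervals (b := (s : ℝ))
    (hcont.intervalIntegrable _ _) (hcont.intervalIntegrable _ _)]
  rw [intervalIntegral.integral_congr (a := 0) (b := (s : ℝ))
    (g := fun t => (-1 * (t - s) * G.len e - (t - s) ^ 2) / G.len e) fun t ht => by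
      rw [Set.uIcc_of_le s.2.1.le] at ht
      simp only
      rw [abs_of_nonneg (sub_nonneg.2 ht.2)]
      ring,
    intervalIntegral.integral_congr (a := (s : ℝ)) (b := G.len e)
    (g := fun t => (1 * (t - s) * G.len e - (t - s) ^ 2) / G.len e) fun t ht => by
      rw [Set.uIcc_of_le s.2.2.le] at ht
      simp only
      rw [abs_of_nonpos (sub_nonpos.2 ht.1)]
      ring,
    intervalIntegral.integral_eq_sub_of_hasDerivAt (fun t _ => h (-1) t)
      (Continuous.intervalIntegrable (by fun_prop) _ _),
    intervalIntegral.integral_eq_sub_of_hasDerivAt (fun t _ => h 1 t)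
      (Continuous.intervalIntegrable (by fun_prop) _ _)]
  field_simp
  ring

/-- All other edges keep their weights, so the two measures differ by `1/g` times the uniform
probability on the loop minus the point mass at its base. -/
theorem integral_muAd_loop {G : MetricMultigraph V E} {q : V → ℕ} (hg : 0 < G.genus q) {e : E}
    (he : G.src e = G.tgt e) {F : G.Point → ℝ} (hF : Measurable F) {C : ℝ}
    (hC : ∀ x, ‖F x‖ ≤ C) :
    ∫ x, F x ∂G.muAd q =
      ∫ x, F (G.ofDeleteEdge e x)
          ∂(G.deleteEdge e).muAd (Function.update q (G.src e) (q (G.src e) + 1)) +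
        (G.genus q : ℝ)⁻¹ * ((G.len e)⁻¹ * ∫ t, F (G.onEdge e t) ∂G.paramMeasure e -
          F (G.vertex (G.src e))) := by
  have hq : ∑ v, ((Function.update q (G.src e) (q (G.src e) + 1) v : ℕ) : ℝ) * F (G.vertex v) =
      ∑ v, (q v : ℝ) * F (G.vertex v) + F (G.vertex (G.src e)) := by
    have : ∀ v, ((Function.update q (G.src e) (q (G.src e) + 1) v : ℕ) : ℝ) =
        q v + if v = G.src e then 1 else 0 := fun v => by
      rw [Function.update_apply]
      split_ifs with h
      · rw [h]
        push_cast
        rfl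
      · simp
    simp [this, add_mul, Finset.sum_add_distrib]
  rw [integral_muAd hg hF hC,
    integral_muAd (F := fun x => F (G.ofDeleteEdge e x)) (by rwa [genus_deleteEdge])
      (hF.comp (G.measurable_ofDeleteEdge e))
      (fun x => hC _), genus_deleteEdge,
    Fintype.sum_eq_add_sum_subtype_ne (fun e => ((ENNReal.ofReal (G.len e) +
      G.edgeRes e)⁻¹).toReal * ∫ t, F (G.onEdge e t) ∂G.paramMeasure e) e,
    edgeRes_loop he, add_zero, ENNReal.toReal_inv, ENNReal.toReal_ofReal (G.len_pos e).le]
  simp only [edgeRes_deleteEdge_loop he]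
  have hv : ∀ v, F (G.ofDeleteEdge e ((G.deleteEdge e).vertex v)) = F (G.vertex v) :=
    fun _ => rfl
  have hs : ∑ e' : {e' : E // e' ≠ e},
      ((ENNReal.ofReal ((G.deleteEdge e).len e') + G.edgeRes e')⁻¹).toReal *
        ∫ t, F (G.ofDeleteEdge e ((G.deleteEdge e).onEdge e' t)) ∂(G.deleteEdge e).paramMeasure e' =
      ∑ e' : {e' : E // e' ≠ e}, ((ENNReal.ofReal (G.len e') + G.edgeRes e')⁻¹).toReal *
        ∫ t, F (G.onEdge e' t) ∂G.paramMeasure e' := rfl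
  simp only [hv]
  rw [hs, hq]
  ring

/-- Away from the loop, the potential of the admissible measure changes by a constant. -/
theorem IsPMGraph.integral_r_ofDeleteEdge {G : MetricMultigraph V E} {q : V → ℕ}
    (hG : G.IsPMGraph q) {e : E} (he : G.src e = G.tgt e) (x : (G.deleteEdge e).Point) :
    ∫ y, G.r (G.ofDeleteEdge e x) y ∂G.muAd q =
      ∫ y, (G.deleteEdge e).r x y
          ∂(G.deleteEdge e).muAd (Function.update q (G.src e) (q (G.src e) + 1)) +
        (G.genus q : ℝ)⁻¹ * (G.len e / 6) := by
  obtain ⟨C, hC⟩ := hG.1.exists_bound_r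
  rw [integral_muAd_loop hG.genus_pos he (hG.1.measurable_r_right _) (hC _)]
  simp only [hG.1.r_ofDeleteEdge he, hG.1.r_ofDeleteEdge_loop he]
  rw [integral_add (integrable_const _) ?_, integral_const, Measure.real, paramMeasure_univ,
    ENNReal.toReal_ofReal (G.len_pos e).le, integral_loop_parabola]
  · have hl := (G.len_pos e).ne'
    congr 2
    rw [smul_eq_mul]
    field_simp
    ring
  · refine Integrable.of_bound (by fun_prop) (G.len e) (ae_of_all _ fun t => ?_)
    have h1 := t.2.1
    have h2 := sub_pos.2 t.2.2
    rw [Real.norm_of_nonneg (div_nonneg (mul_pos h1 h2).le (G.len_pos e).le),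
      div_le_iff₀ (G.len_pos e)]
    exact mul_le_mul t.2.2.le (by linarith) h2.le (G.len_pos e).le

/-- The potential of the admissible measure along the loop. -/
theorem IsPMGraph.integral_r_loop {G : MetricMultigraph V E} {q : V → ℕ}
    (hG : G.IsPMGraph q) {e : E} (he : G.src e = G.tgt e) (s : Set.Ioo (0 : ℝ) (G.len e)) :
    ∫ y, G.r (G.onEdge e s) y ∂G.muAd q =
      ∫ y, G.r (G.vertex (G.src e)) y ∂G.muAd q +
        (1 - (G.genus q : ℝ)⁻¹) * (s * (G.len e - s) / G.len e) := by
  obtain ⟨C, hC⟩ := hG.1.exists_bound_r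
  have hd := hG.deleteEdge_loop he
  have hfin := isFiniteMeasure_muAd hd.genus_pos
  have hl := (G.len_pos e).ne'
  have hr : Integrable (fun y => G.r (G.vertex (G.src e)) (G.ofDeleteEdge e y))
      ((G.deleteEdge e).muAd (Function.update q (G.src e) (q (G.src e) + 1))) :=
    Integrable.of_bound ((hG.1.measurable_r_right _).comp
      (G.measurable_ofDeleteEdge e)).aestronglyMeasurable C (ae_of_all _ fun y => hC _ _)
  have h0 := hG.integral_r_ofDeleteEdge he ((G.deleteEdge e).vertex (G.src e))
  rw [ofDeleteEdge_vertex] at h0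
  have hp : G.r (G.onEdge e s) (G.vertex (G.src e)) = s * (G.len e - s) / G.len e := by
    have := hG.1.r_loop_ofDeleteEdge he ((G.deleteEdge e).vertex (G.src e)) s
    rwa [ofDeleteEdge_vertex, hG.1.r_vertex_self, zero_add] at this
  rw [h0, integral_muAd_loop hG.genus_pos he (hG.1.measurable_r_right _) (hC _), hp]
  simp only [hG.1.r_loop_ofDeleteEdge he, hG.1.r_loop_loop he, integral_loop_abs]
  rw [integral_add hr (integrable_const _), integral_const_muAd hd.1 hd.genus_pos]
  have hv : ∀ y, G.r (G.vertex (G.src e)) (G.ofDeleteEdge e y) =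
      (G.deleteEdge e).r ((G.deleteEdge e).vertex (G.src e)) y := fun y =>
    hG.1.r_ofDeleteEdge he ((G.deleteEdge e).vertex (G.src e)) y
  simp only [hv]
  field_simp
  ring

/-- `K` is the same on both graphs and charges only vertices, where the potential shifts by `L /
(6g)`; its degree `2g - 2` multiplies this shift. -/
theorem IsPMGraph.epsilonInv_loop {G : MetricMultigraph V E} {q : V → ℕ}
    (hG : G.IsPMGraph q) {e : E} (he : G.src e = G.tgt e) :
    G.epsilonInv q =
      (G.deleteEdge e).epsilonInv (Function.update q (G.src e) (q (G.src e) + 1)) +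
        ((G.genus q : ℝ) - 1) / (3 * G.genus q) * G.len e := by
  have hd := hG.deleteEdge_loop he
  obtain ⟨C, hC⟩ := hG.exists_bound_integral_r
  obtain ⟨C', hC'⟩ := hd.exists_bound_integral_r
  have hg : (G.genus q : ℝ) ≠ 0 := by exact_mod_cast hG.genus_pos.ne'
  have hK : ∑ v, (G.K q v : ℝ) = 2 * G.genus q - 2 := by
    have := congrArg (Int.cast : ℤ → ℝ) (G.sum_K q)
    push_cast at this
    exact this
  rw [epsilonInv, epsilonInv, integral_deltaK hG.2 hG.measurable_integral_r hC,
    integral_deltaK hd.2 hd.measurable_integral_r hC']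
  simp only [K_deleteEdge_loop he]
  simp only [← G.ofDeleteEdge_vertex e, hG.integral_r_ofDeleteEdge he, mul_add,
    Finset.sum_add_distrib, ← Finset.sum_mul, hK]
  field_simp
  ring

/-- The constant shift contributes `L / (6g)`, the excess along the loop contributes `(1/g) (1 -
1/g) L / 6`, and Z is half of the total. -/
theorem IsPMGraph.zInv_loop {G : MetricMultigraph V E} {q : V → ℕ}
    (hG : G.IsPMGraph q) {e : E} (he : G.src e = G.tgt e) :
    G.zInv q =
      (G.deleteEdge e).zInv (Function.update q (G.src e) (q (G.src e) + 1)) +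
        (2 * (G.genus q : ℝ) - 1) / (12 * (G.genus q : ℝ) ^ 2) * G.len e := by
  have hd := hG.deleteEdge_loop he
  have hfin := isFiniteMeasure_muAd hd.genus_pos
  obtain ⟨C, hC⟩ := hG.exists_bound_integral_r
  obtain ⟨C', hC'⟩ := hd.exists_bound_integral_r
  have hg : (G.genus q : ℝ) ≠ 0 := by exact_mod_cast hG.genus_pos.ne'
  have hl := (G.len_pos e).ne'
  have hpar : Integrable (fun t : Set.Ioo (0 : ℝ) (G.len e) =>
      (1 - (G.genus q : ℝ)⁻¹) * ((t : ℝ) * (G.len e - t) / G.len e)) (G.paramMeasure e) := by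
    -- A nonzero integral certifies integrability, since a non-integrable function has integral zero
    -- by convention.
    refine Integrable.const_mul (not_imp_comm.1 integral_undef ?_) _
    rw [integral_loop_parabola]
    positivity
  rw [zInv, zInv, integral_muAd_loop hG.genus_pos he hG.measurable_integral_r hC]
  simp only [hG.integral_r_ofDeleteEdge he, hG.integral_r_loop he]
  rw [integral_add (Integrable.of_bound hd.measurable_integral_r.aestronglyMeasurable C'
      (ae_of_all _ hC')) (integrable_const _), integral_const_muAd hd.1 hd.genus_pos,
    integral_add (integrable_const _) hpar, integral_const, integral_const_mul,
    integral_loop_parabola, Measure.real, paramMeasure_univ,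
    ENNReal.toReal_ofReal (G.len_pos e).le, smul_eq_mul]
  field_simp
  ring

end Loop

end MetricMultigraph
end

theorem mainTheorem4 {V E : Type*} [DecidableEq V] [DecidableEq E] [Fintype V] [Fintype E]
    (Γ : MetricMultigraph V E) (q : V → ℕ) (hΓ : Γ.IsPMGraph q)
    (p : V) (loop : E) (hsrc : Γ.src loop = p) (htgt : Γ.tgt loop = p)
    (hp : 3 ≤ Γ.valence p)
    (L : ℝ) (hL : Γ.len loop = L)
    (β : MetricMultigraph V {e : E // e ≠ loop}) (hβ : β = Γ.deleteEdge loop)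
    (q' : V → ℕ) (hq' : q' = Function.update q p (q p + 1))
    (g : ℝ) (hg : g = (Γ.genus q : ℝ)) :
    β.IsPMGraph q' ∧
    β.genus q' = Γ.genus q ∧
    Γ.phiInv q = β.phiInv q' + (g - 1) / (6 * g) * L ∧
    Γ.zInv q = β.zInv q' + (2 * g - 1) / (12 * g ^ 2) * L ∧
    Γ.lambdaInv q = β.lambdaInv q' + g / (8 * g + 4) * L ∧
    Γ.epsilonInv q = β.epsilonInv q' + (g - 1) / (3 * g) * L := by
  have he : Γ.src loop = Γ.tgt loop := hsrc.trans htgt.symm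
  subst hβ hq' hL hsrc
  have hgen := Γ.genus_deleteEdge loop q (Γ.src loop)
  have hpos : 0 < g := by
    rw [hg]
    exact_mod_cast hΓ.genus_pos
  have hz := hΓ.zInv_loop he
  have hε := hΓ.epsilonInv_loop he
  have hℓ := Γ.totalLength_deleteEdge loop
  rw [← hg] at hz hε
  -- Both ε and the total length jump, and `(2g-1)/(4g) - (1/4) ((g-1)/(3g) + 1) = (g-1)/(6g)`.
  have hφ : Γ.phiInv q = (Γ.deleteEdge loop).phiInv
      (Function.update q (Γ.src loop) (q (Γ.src loop) + 1)) + (g - 1) / (6 * g) * Γ.len loop := by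
    rw [MetricMultigraph.phiInv, MetricMultigraph.phiInv, hgen, hz, hε, hℓ, ← hg]
    field_simp
    ring
  refine ⟨hΓ.deleteEdge_loop he, hgen, hφ, hz, ?_, hε⟩
  rw [MetricMultigraph.lambdaInv, MetricMultigraph.lambdaInv, hgen, hφ, hε, hℓ, ← hg]
  field_simp
  ring
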